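/- Let $\mathfrak{C}$ be a category with all finite limits. An internal category $\mathcal{H}$ in $\mathfrak{C}$ consists of objects $H_0$ (objects) and $H_1$ (arrows) with source and target $s,t\colon H_1\to H_0$, identities $e\colon H_0\to H_1$ and composition $m\colon H_1\times_{H_0}H_1\to H_1$ satisfying the usual category axioms; an internal functor $\Phi\colon\mathcal{H}\to\mathcal{K}$ is a pair $\Phi_0\colon H_0\to K_0$, $\Phi_1\colon H_1\to K_1$ commuting with this structure. An internal functor $p\colon\mathcal{X}\to\mathcal{K}$ is a \emph{discrete opfibration} if the square with sides $s\colon X_1\to X_0$, $p_1\colon X_1\to K_1$, $p_0\colon X_0\to K_0$, $s\colon K_1\to K_0$ is a pullback. Let $\mathbf{doFib}(\mathcal{K})$ be the category whose objects are the discrete opfibrations over $\mathcal{K}$ and whose morphisms are the internal functors between their domains that commute with the functors to $\mathcal{K}$. Discrete opfibrations are stable under pullback of internal categories (computed on objects and on arrows), so every internal functor $\Phi\colon\mathcal{H}\to\mathcal{K}$ induces a pullback functor $\Phi^*\colon\mathbf{doFib}(\mathcal{K})\to\mathbf{doFib}(\mathcal{H})$. An internal functor $\Phi\colon\mathcal{H}\to\mathcal{K}$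 is \emph{fully faithful} if the square with sides $\Phi_1\colon H_1\to K_1$, $(s,t)\colon H_1\to H_0\times H_0$, $(s,t)\colon K_1\to K_0\times K_0$, $\Phi_0\times\Phi_0$ is a pullback. A morphism $f\colon X\to Y$ of $\mathfrak{C}$ is an \emph{effective descent morphism} if, regarding the kernel pair $X\times_Y X\rightrightarrows X$ as an internal category with object of objects $X$, regarding $Y$ as a categorically discrete internal category, and regarding $f$ as an internal functor from the former to the latter, the pullback functor $f^*$ from discrete opfibrations over $Y$ to discrete opfibrations over the kernel pair is an equivalence of categories. \textbf{Theorem.} Let $\Phi\colon\mathcal{H}\to\mathcal{K}$ be an internal functor between internal categories in $\mathfrak{C}$. If $\Phi$ is fully faithful and $\Phi_0\colon H_0\to K_0$ is an effective descent morphism in $\mathfrak{C}$, then the pullback functor $\Phi^*\colon\mathbf{doFib}(\mathcal{K})\to\mathbf{doFib}(\mathcal{H})$ is an equivalence of categories. -/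

import Mathlib

open CategoryTheory CategoryTheory.Limits

universe v u

/-- An internal category in a finitely complete category `C`. The multiplication `m` takes its
arguments in diagrammatic order: it is defined on the pairs `(f, g)` with `t f = s g`. -/
structure InternalCategory (C : Type u) [Category.{v} C] [HasFiniteLimits C] where
  /-- the object of objects -/
  obj : C
  /-- the object of arrows -/
  arr : C
  /-- source -/
  s : arr ⟶ obj
  /-- target -/
  t : arr ⟶ obj
  /-- identities -/
  e : obj ⟶ arr
  /-- composition -/
  m : pullback t s ⟶ arr
  e_s : e ≫ s = 𝟙 obj
  e_t : e ≫ t = 𝟙 obj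
  m_s : m ≫ s = pullback.fst t s ≫ s
  m_t : m ≫ t = pullback.snd t s ≫ t
  /-- Associativity, on the object of composable triples `((f, g), h)`. -/
  m_assoc :
    pullback.lift
        (pullback.fst (pullback.snd t s ≫ t) s ≫ m)
        (pullback.snd (pullback.snd t s ≫ t) s)
        (by rw [Category.assoc, m_t, pullback.condition]) ≫ m =
      pullback.lift
        (pullback.fst (pullback.snd t s ≫ t) s ≫ pullback.fst t s)
        (pullback.lift
            (pullback.fst (pullback.snd t s ≫ t) s ≫ pullback.snd t s)
            (pullback.snd (pullback.snd t s ≫ t) s)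
            (by rw [Category.assoc, pullback.condition]) ≫ m)
        (by rw [Category.assoc, Category.assoc, m_s, pullback.lift_fst_assoc, Category.assoc,
              pullback.condition]) ≫ m
  e_m : pullback.lift (s ≫ e) (𝟙 arr)
    (by rw [Category.assoc, e_t, Category.comp_id, Category.id_comp]) ≫ m = 𝟙 arr
  m_e : pullback.lift (𝟙 arr) (t ≫ e)
    (by rw [Category.assoc, e_s, Category.comp_id, Category.id_comp]) ≫ m = 𝟙 arr

namespace InternalCategory

variable {C : Type u} [Category.{v} C] [HasFiniteLimits C]

attribute [local simp] pullback.lift_fst pullback.lift_snd pullback.lift_fst_assoc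
  pullback.lift_snd_assoc

/-- The composite of two composable generalised arrows `f g : T ⟶ H.arr`. -/
noncomputable def comp (H : InternalCategory C) {T : C} (f g : T ⟶ H.arr)
    (h : f ≫ H.t = g ≫ H.s) : T ⟶ H.arr :=
  pullback.lift f g h ≫ H.m

section Lemmas

variable (H : InternalCategory C) {T : C}

theorem comp_s (f g : T ⟶ H.arr) (h : f ≫ H.t = g ≫ H.s) : H.comp f g h ≫ H.s = f ≫ H.s := by
  rw [comp, Category.assoc, H.m_s, pullback.lift_fst_assoc]

theorem comp_t (f g : T ⟶ H.arr) (h : f ≫ H.t = g ≫ H.s) : H.comp f g h ≫ H.t = g ≫ H.t := by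
  rw [comp, Category.assoc, H.m_t, pullback.lift_snd_assoc]

theorem precomp_comp {S : C} (x : S ⟶ T) (f g : T ⟶ H.arr) (h : f ≫ H.t = g ≫ H.s) :
    x ≫ H.comp f g h =
      H.comp (x ≫ f) (x ≫ g) (by rw [Category.assoc, Category.assoc, h]) := by
  rw [comp, comp, ← Category.assoc]
  congr 1
  apply pullback.hom_ext <;> simp

theorem comp_congr {f f' g g' : T ⟶ H.arr} (hf : f = f') (hg : g = g')
    (h : f ≫ H.t = g ≫ H.s) : H.comp f g h = H.comp f' g' (by rw [← hf, ← hg, h]) := by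
  subst hf hg
  rfl

theorem m_eq_comp : H.m = H.comp (pullback.fst _ _) (pullback.snd _ _) pullback.condition := by
  have : pullback.lift (pullback.fst H.t H.s) (pullback.snd H.t H.s) pullback.condition = 𝟙 _ := by
    apply pullback.hom_ext <;> simp
  rw [comp, this, Category.id_comp]

theorem comp_assoc (f g h : T ⟶ H.arr) (hfg : f ≫ H.t = g ≫ H.s) (hgh : g ≫ H.t = h ≫ H.s) :
    H.comp (H.comp f g hfg) h (by rw [comp_t, hgh]) =
      H.comp f (H.comp g h hgh) (by rw [comp_s, hfg]) := by
  have key := congrArg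
    (fun k => pullback.lift (f := pullback.snd H.t H.s ≫ H.t) (g := H.s)
      (pullback.lift f g hfg) h (by rw [pullback.lift_snd_assoc, hgh]) ≫ k) H.m_assoc
  simp only [← Category.assoc] at key
  unfold comp
  convert key using 2
  · apply pullback.hom_ext <;> simp
  · apply pullback.hom_ext
    · simp
    · simp only [pullback.lift_snd, Category.assoc]
      rw [← Category.assoc]
      congr 1
      apply pullback.hom_ext <;> simp

theorem e_comp (f : T ⟶ H.arr) :
    H.comp (f ≫ H.s ≫ H.e) f (by simp only [Category.assoc, H.e_t, Category.comp_id]) = f := by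
  have key := congrArg (fun k => f ≫ k) H.e_m
  simp only [← Category.assoc, Category.comp_id] at key
  refine Eq.trans ?_ key
  unfold comp
  congr 1
  apply pullback.hom_ext <;> simp

theorem comp_e (f : T ⟶ H.arr) :
    H.comp f (f ≫ H.t ≫ H.e) (by simp only [Category.assoc, H.e_s, Category.comp_id]) = f := by
  have key := congrArg (fun k => f ≫ k) H.m_e
  simp only [← Category.assoc, Category.comp_id] at key
  refine Eq.trans ?_ key
  unfold comp
  congr 1
  apply pullback.hom_ext <;> simp

end Lemmas

/-- Internal functors. -/
@[ext]
structure Hom (H K : InternalCategory C) where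
  /-- the action on objects -/
  obj : H.obj ⟶ K.obj
  /-- the action on arrows -/
  arr : H.arr ⟶ K.arr
  arr_s : arr ≫ K.s = H.s ≫ obj
  arr_t : arr ≫ K.t = H.t ≫ obj
  e_arr : H.e ≫ arr = obj ≫ K.e
  m_arr : H.m ≫ arr =
    pullback.lift (pullback.fst H.t H.s ≫ arr) (pullback.snd H.t H.s ≫ arr)
      (by rw [Category.assoc, Category.assoc, arr_t, arr_s, pullback.condition_assoc]) ≫ K.m

theorem Hom.comp_arr {H K : InternalCategory C} (F : Hom H K) {T : C} (f g : T ⟶ H.arr)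
    (h : f ≫ H.t = g ≫ H.s) :
    H.comp f g h ≫ F.arr = K.comp (f ≫ F.arr) (g ≫ F.arr)
      (by simp only [Category.assoc, F.arr_t, F.arr_s]; rw [← Category.assoc, h,
            Category.assoc]) := by
  unfold comp
  rw [Category.assoc, F.m_arr, ← Category.assoc]
  congr 1
  apply pullback.hom_ext <;> simp

/-- The category of internal categories and internal functors in `C`. -/
instance : Category (InternalCategory C) where
  Hom := Hom
  id H :=
    { obj := 𝟙 _
      arr := 𝟙 _
      arr_s := by simp
      arr_t := by simp
      e_arr := by simp
      m_arr := by
        simp }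
  comp {H K L} F G :=
    { obj := F.obj ≫ G.obj
      arr := F.arr ≫ G.arr
      arr_s := by rw [Category.assoc, G.arr_s, ← Category.assoc, F.arr_s, Category.assoc]
      arr_t := by rw [Category.assoc, G.arr_t, ← Category.assoc, F.arr_t, Category.assoc]
      e_arr := by rw [← Category.assoc, F.e_arr, Category.assoc, G.e_arr, Category.assoc]
      m_arr := by
        rw [H.m_eq_comp, ← Category.assoc, F.comp_arr, G.comp_arr]
        unfold comp
        simp only [Category.assoc] }
  id_comp F := by apply Hom.ext <;> exact Category.id_comp _
  comp_id F := by apply Hom.ext <;> exact Category.comp_id _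
  assoc F G H := by apply Hom.ext <;> exact Category.assoc _ _ _

@[ext]
theorem hom_ext {H K : InternalCategory C} {F G : H ⟶ K} (h₀ : F.obj = G.obj)
    (h₁ : F.arr = G.arr) : F = G :=
  Hom.ext h₀ h₁

@[simp] theorem id_obj (H : InternalCategory C) : (𝟙 H : H ⟶ H).obj = 𝟙 H.obj := rfl

@[simp] theorem id_arr (H : InternalCategory C) : (𝟙 H : H ⟶ H).arr = 𝟙 H.arr := rfl

@[simp] theorem comp_obj' {H K L : InternalCategory C} (F : H ⟶ K) (G : K ⟶ L) :
    (F ≫ G).obj = F.obj ≫ G.obj := rfl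

@[simp] theorem comp_arr' {H K L : InternalCategory C} (F : H ⟶ K) (G : K ⟶ L) :
    (F ≫ G).arr = F.arr ≫ G.arr := rfl

/-! ### Classes of internal functors -/

/-- An internal functor is a discrete opfibration if the square formed with the source maps is a
pullback. -/
def IsDiscreteOpfibration {H K : InternalCategory C} (F : H ⟶ K) : Prop :=
  IsPullback H.s F.arr F.obj K.s

/-- An internal functor is fully faithful if the square formed with the maps `(s, t)` is a
pullback. -/
def IsFullyFaithful {H K : InternalCategory C} (F : H ⟶ K) : Prop :=
  IsPullback F.arr (prod.lift H.s H.t) (prod.lift K.s K.t) (prod.map F.obj F.obj)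

/-- Discrete opfibrations as a class of objects of the slice category `Cat(C)/K`. -/
def isDiscreteOpfibration (K : InternalCategory C) : ObjectProperty (Over K) :=
  fun p => IsDiscreteOpfibration p.hom

/-- The category of discrete opfibrations over `K`: its morphisms are the internal functors over
`K`. -/
abbrev DOFib (K : InternalCategory C) : Type (max u v) := (isDiscreteOpfibration K).FullSubcategory

/-! ### Pullback of internal functors -/

section Pullback

variable {X H K : InternalCategory C} (p : X ⟶ K) (Φ : H ⟶ K)

/-- The pullback `X ×_K H`, computed on objects and on arrows. -/
noncomputable def pb : InternalCategory C where
  obj := pullback p.obj Φ.obj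
  arr := pullback p.arr Φ.arr
  s := pullback.map _ _ _ _ X.s H.s K.s p.arr_s Φ.arr_s
  t := pullback.map _ _ _ _ X.t H.t K.t p.arr_t Φ.arr_t
  e := pullback.map _ _ _ _ X.e H.e K.e p.e_arr.symm Φ.e_arr.symm
  m := pullback.lift
    (X.comp (pullback.fst _ _ ≫ pullback.fst _ _) (pullback.snd _ _ ≫ pullback.fst _ _)
      (by simpa using congrArg (· ≫ pullback.fst _ _) (pullback.condition
        (f := pullback.map _ _ _ _ X.t H.t K.t p.arr_t Φ.arr_t)
        (g := pullback.map _ _ _ _ X.s H.s K.s p.arr_s Φ.arr_s))))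
    (H.comp (pullback.fst _ _ ≫ pullback.snd _ _) (pullback.snd _ _ ≫ pullback.snd _ _)
      (by simpa using congrArg (· ≫ pullback.snd _ _) (pullback.condition
        (f := pullback.map _ _ _ _ X.t H.t K.t p.arr_t Φ.arr_t)
        (g := pullback.map _ _ _ _ X.s H.s K.s p.arr_s Φ.arr_s))))
    (by
      rw [p.comp_arr, Φ.comp_arr]
      apply comp_congr <;> simp only [Category.assoc, pullback.condition])
  e_s := by
    apply pullback.hom_ext <;> simp [X.e_s, H.e_s]
  e_t := by
    apply pullback.hom_ext <;> simp [X.e_t, H.e_t]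
  m_s := by
    apply pullback.hom_ext <;> simp [comp_s]
  m_t := by
    apply pullback.hom_ext <;> simp [comp_t]
  m_assoc := by
    apply pullback.hom_ext
    · simp only [Category.assoc, pullback.lift_fst, precomp_comp]
      simp only [pullback.lift_fst_assoc, pullback.lift_snd_assoc, Category.assoc,
        pullback.lift_fst, precomp_comp]
      exact X.comp_assoc _ _ _ _ _
    · simp only [Category.assoc, pullback.lift_snd, precomp_comp]
      simp only [pullback.lift_fst_assoc, pullback.lift_snd_assoc, Category.assoc,
        pullback.lift_snd, precomp_comp]
      exact H.comp_assoc _ _ _ _ _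
  e_m := by
    apply pullback.hom_ext
    · simp only [Category.assoc, pullback.lift_fst, precomp_comp, Category.id_comp]
      refine Eq.trans (X.comp_congr ?_ ?_ _) (X.e_comp (pullback.fst _ _)) <;> simp
    · simp only [Category.assoc, pullback.lift_snd, precomp_comp, Category.id_comp]
      refine Eq.trans (H.comp_congr ?_ ?_ _) (H.e_comp (pullback.snd _ _)) <;> simp
  m_e := by
    apply pullback.hom_ext
    · simp only [Category.assoc, pullback.lift_fst, precomp_comp, Category.id_comp]
      refine Eq.trans (X.comp_congr ?_ ?_ _) (X.comp_e (pullback.fst _ _)) <;> simp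
    · simp only [Category.assoc, pullback.lift_snd, precomp_comp, Category.id_comp]
      refine Eq.trans (H.comp_congr ?_ ?_ _) (H.comp_e (pullback.snd _ _)) <;> simp

/-- The projection `X ×_K H ⟶ X`. -/
noncomputable def pbFst : pb p Φ ⟶ X where
  obj := pullback.fst p.obj Φ.obj
  arr := pullback.fst p.arr Φ.arr
  arr_s := by simp [pb]
  arr_t := by simp [pb]
  e_arr := by simp [pb]
  m_arr := pullback.lift_fst _ _ _

/-- The projection `X ×_K H ⟶ H`. -/
noncomputable def pbSnd : pb p Φ ⟶ H where
  obj := pullback.snd p.obj Φ.obj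
  arr := pullback.snd p.arr Φ.arr
  arr_s := by simp [pb]
  arr_t := by simp [pb]
  e_arr := by simp [pb]
  m_arr := pullback.lift_snd _ _ _

variable {p Φ} in
/-- The functor into `X ×_K H` induced by a commutative square. -/
noncomputable def pbLift {Z : InternalCategory C} (F : Z ⟶ X) (G : Z ⟶ H) (w : F ≫ p = G ≫ Φ) :
    Z ⟶ pb p Φ where
  obj := pullback.lift F.obj G.obj (congrArg Hom.obj w)
  arr := pullback.lift F.arr G.arr (congrArg Hom.arr w)
  arr_s := by apply pullback.hom_ext <;> simp [pb, F.arr_s, G.arr_s]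
  arr_t := by apply pullback.hom_ext <;> simp [pb, F.arr_t, G.arr_t]
  e_arr := by apply pullback.hom_ext <;> simp [pb, F.e_arr, G.e_arr]
  m_arr := by
    have hL : (pullback.fst Z.t Z.s ≫ pullback.lift F.arr G.arr (congrArg Hom.arr w)) ≫
        (pb p Φ).t = (pullback.snd Z.t Z.s ≫ pullback.lift F.arr G.arr (congrArg Hom.arr w)) ≫
        (pb p Φ).s := by
      have hw := pullback.condition (f := Z.t) (g := Z.s)
      apply pullback.hom_ext
      · simp [pb]
        simp [F.arr_s, F.arr_t, reassoc_of% hw]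
      · simp [pb]
        simp [G.arr_s, G.arr_t, reassoc_of% hw]
    apply pullback.hom_ext
    · have h := (pbFst p Φ).comp_arr
        (pullback.fst Z.t Z.s ≫ pullback.lift F.arr G.arr (congrArg Hom.arr w))
        (pullback.snd Z.t Z.s ≫ pullback.lift F.arr G.arr (congrArg Hom.arr w)) hL
      have h' : (Z.m ≫ pullback.lift F.arr G.arr (congrArg Hom.arr w)) ≫ pullback.fst _ _ =
          X.comp (pullback.fst Z.t Z.s ≫ F.arr) (pullback.snd Z.t Z.s ≫ F.arr) (by
            rw [Category.assoc, Category.assoc, F.arr_t, F.arr_s, pullback.condition_assoc]) := by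
        rw [Category.assoc, pullback.lift_fst, Z.m_eq_comp, F.comp_arr]
      refine h'.trans (Eq.trans (comp_congr _ ?_ ?_ _) h.symm)
      · exact (congrArg (pullback.fst Z.t Z.s ≫ ·) (pullback.lift_fst F.arr G.arr
          (congrArg Hom.arr w)).symm).trans (Category.assoc _ _ _).symm
      · exact (congrArg (pullback.snd Z.t Z.s ≫ ·) (pullback.lift_fst F.arr G.arr
          (congrArg Hom.arr w)).symm).trans (Category.assoc _ _ _).symm
    · have h := (pbSnd p Φ).comp_arr
        (pullback.fst Z.t Z.s ≫ pullback.lift F.arr G.arr (congrArg Hom.arr w))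
        (pullback.snd Z.t Z.s ≫ pullback.lift F.arr G.arr (congrArg Hom.arr w)) hL
      have h' : (Z.m ≫ pullback.lift F.arr G.arr (congrArg Hom.arr w)) ≫ pullback.snd _ _ =
          H.comp (pullback.fst Z.t Z.s ≫ G.arr) (pullback.snd Z.t Z.s ≫ G.arr) (by
            rw [Category.assoc, Category.assoc, G.arr_t, G.arr_s, pullback.condition_assoc]) := by
        rw [Category.assoc, pullback.lift_snd, Z.m_eq_comp, G.comp_arr]
      refine h'.trans (Eq.trans (comp_congr _ ?_ ?_ _) h.symm)
      · exact (congrArg (pullback.fst Z.t Z.s ≫ ·) (pullback.lift_snd F.arr G.arr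
          (congrArg Hom.arr w)).symm).trans (Category.assoc _ _ _).symm
      · exact (congrArg (pullback.snd Z.t Z.s ≫ ·) (pullback.lift_snd F.arr G.arr
          (congrArg Hom.arr w)).symm).trans (Category.assoc _ _ _).symm

variable {p Φ} in
theorem pbLift_fst {Z : InternalCategory C} (F : Z ⟶ X) (G : Z ⟶ H) (w : F ≫ p = G ≫ Φ) :
    pbLift F G w ≫ pbFst p Φ = F :=
  hom_ext (pullback.lift_fst F.obj G.obj (congrArg Hom.obj w))
    (pullback.lift_fst F.arr G.arr (congrArg Hom.arr w))

variable {p Φ} in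
theorem pbLift_snd {Z : InternalCategory C} (F : Z ⟶ X) (G : Z ⟶ H) (w : F ≫ p = G ≫ Φ) :
    pbLift F G w ≫ pbSnd p Φ = G :=
  hom_ext (pullback.lift_snd F.obj G.obj (congrArg Hom.obj w))
    (pullback.lift_snd F.arr G.arr (congrArg Hom.arr w))

variable {p Φ} in
theorem pb_hom_ext {Z : InternalCategory C} {F G : Z ⟶ pb p Φ}
    (h₁ : F ≫ pbFst p Φ = G ≫ pbFst p Φ) (h₂ : F ≫ pbSnd p Φ = G ≫ pbSnd p Φ) : F = G :=
  hom_ext (pullback.hom_ext (congrArg Hom.obj h₁) (congrArg Hom.obj h₂))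
    (pullback.hom_ext (congrArg Hom.arr h₁) (congrArg Hom.arr h₂))

/-- `X ×_K H` is the pullback in the category of internal categories. -/
theorem isPullback_pb : IsPullback (pbFst p Φ) (pbSnd p Φ) p Φ where
  w := hom_ext pullback.condition pullback.condition
  isLimit' := ⟨PullbackCone.IsLimit.mk _ (fun c => pbLift c.fst c.snd c.condition)
    (fun _ => pbLift_fst _ _ _) (fun _ => pbLift_snd _ _ _)
    (fun _ _ h₁ h₂ => pb_hom_ext (h₁.trans (pbLift_fst _ _ _).symm)
      (h₂.trans (pbLift_snd _ _ _).symm))⟩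

/-- Pullback along `Φ : H ⟶ K` as a functor `Cat(C)/K ⥤ Cat(C)/H`. -/
noncomputable def overPullback : Over K ⥤ Over H where
  obj q := Over.mk (pbSnd q.hom Φ)
  map {q r} k := Over.homMk
    ((isPullback_pb r.hom Φ).lift (pbFst q.hom Φ ≫ k.left) (pbSnd q.hom Φ)
      (by rw [Category.assoc, Over.w, (isPullback_pb q.hom Φ).w]))
    ((isPullback_pb r.hom Φ).lift_snd _ _ _)
  map_id q := by
    ext1
    apply (isPullback_pb q.hom Φ).hom_ext <;> simp
  map_comp {q r l} k k' := by
    ext1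
    apply (isPullback_pb l.hom Φ).hom_ext <;> simp

variable {p} in
/-- Discrete opfibrations are stable under pullback. -/
theorem IsDiscreteOpfibration.pbSnd (hp : IsDiscreteOpfibration p) :
    IsDiscreteOpfibration (pbSnd p Φ) := by
  have h₁ : IsPullback (pullback.fst p.arr Φ.arr) (pullback.snd p.arr Φ.arr) p.arr Φ.arr :=
    IsPullback.of_hasPullback _ _
  have h₀ : IsPullback (pullback.fst p.obj Φ.obj) (pullback.snd p.obj Φ.obj) p.obj Φ.obj :=
    IsPullback.of_hasPullback _ _
  have h := h₁.flip.paste_vert hp.flip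
  rw [Φ.arr_s] at h
  refine IsPullback.of_right (h₁₂ := pullback.fst p.obj Φ.obj) (h₂₂ := Φ.obj) (v₁₃ := p.obj)
    ?_ (InternalCategory.pbSnd p Φ).arr_s.symm h₀
  have e : (pb p Φ).s ≫ pullback.fst p.obj Φ.obj = pullback.fst p.arr Φ.arr ≫ X.s :=
    (pbFst p Φ).arr_s.symm
  exact e.symm ▸ h.flip

/-- Pullback along `Φ : H ⟶ K` as a functor from discrete opfibrations over `K` to discrete
opfibrations over `H`. -/
noncomputable def DOFib.pullback : DOFib K ⥤ DOFib H :=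
  ObjectProperty.lift _ (ObjectProperty.ι _ ⋙ overPullback Φ)
    (fun q => IsDiscreteOpfibration.pbSnd Φ q.property)

end Pullback

/-! ### Effective descent morphisms -/

/-- An object of `C` as a categorically discrete internal category. -/
noncomputable def disc (Y : C) : InternalCategory C where
  obj := Y
  arr := Y
  s := 𝟙 Y
  t := 𝟙 Y
  e := 𝟙 Y
  m := pullback.fst (𝟙 Y) (𝟙 Y)
  e_s := by simp
  e_t := by simp
  m_s := rfl
  m_t := pullback.condition
  m_assoc := by simp
  e_m := by simp
  m_e := by simp

/-- The kernel pair of `f : X ⟶ Y` as an internal category with object of objects `X`. -/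
noncomputable def kernel {X Y : C} (f : X ⟶ Y) : InternalCategory C where
  obj := X
  arr := pullback f f
  s := pullback.fst f f
  t := pullback.snd f f
  e := pullback.lift (𝟙 X) (𝟙 X) rfl
  m := pullback.lift (pullback.fst _ _ ≫ pullback.fst f f) (pullback.snd _ _ ≫ pullback.snd f f)
    (by
      rw [Category.assoc, Category.assoc, ← pullback.condition (f := f) (g := f),
        ← pullback.condition_assoc, ← pullback.condition (f := f) (g := f)])
  e_s := by simp
  e_t := by simp
  m_s := by simp
  m_t := by simp
  m_assoc := by apply pullback.hom_ext <;> simp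
  e_m := by apply pullback.hom_ext <;> simp
  m_e := by apply pullback.hom_ext <;> simp

/-- `f : X ⟶ Y` as an internal functor from its kernel pair to the discrete category on `Y`. -/
noncomputable def kernelToDisc {X Y : C} (f : X ⟶ Y) : kernel f ⟶ disc Y where
  obj := f
  arr := pullback.fst f f ≫ f
  arr_s := by simp [kernel, disc]
  arr_t := by simp [kernel, disc, pullback.condition]
  e_arr := by simp [kernel, disc]
  m_arr := by
    refine Eq.trans (pullback.lift_fst_assoc _ _ _ _) (Eq.trans ?_ (pullback.lift_fst _ _ _).symm)
    exact Category.assoc _ _ _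

/-- `f : X ⟶ Y` is an effective descent morphism if pulling back along `f` is an equivalence from
discrete opfibrations over `Y` (as a discrete category) to discrete opfibrations over the kernel
pair of `f`. -/
def IsEffectiveDescent {X Y : C} (f : X ⟶ Y) : Prop :=
  (DOFib.pullback (kernelToDisc f)).IsEquivalence

end InternalCategory

/-!
A morphism of effective descent generates a covering sieve for the canonical topology of `C`, so
morphisms of `C` can be defined and compared locally on such covers. For a discrete opfibration,
transport of objects along arrows of the base is a functional relation (`HasLift`), because the
defining square is a pullback; hence it glues.

*Faithfulness and fullness.* Pulling back `Φ.obj` gives a universally effective epimorphism, along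
which the object part of a functor between pullbacks descends. Since `Φ` is fully faithful, every
arrow of `K` between objects in the image of `Φ` comes from an arrow of `H`, so the descended
morphism preserves transport locally, hence globally.

*Essential surjectivity.* Full faithfulness makes the kernel pair of `Φ.obj` a subcategory of `H`,
namely the arrows that `Φ` sends to identities. Restricting `ξ : X ⟶ H` to it yields descent data
for `X.obj`, which therefore descends to some `π : Y ⟶ K.obj`. Locally, an object of `Y` and an
arrow of `K` out of it come from an object of `X` and an arrow of `H`, so `K` acts on `Y` through
the transport in `X`; the category of elements of this action pulls back to `ξ`.
-/

namespace InternalCategory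

/-! ### Gluing along covers of the canonical topology -/

section Gluing

variable {C : Type u} [Category.{v} C] {Z W : C} {S : Sieve Z}

theorem hom_ext_of_cover (hS : S ∈ Sheaf.canonicalTopology C Z) {f g : Z ⟶ W}
    (h : ∀ ⦃T : C⦄ (z : T ⟶ Z), S z → z ≫ f = z ≫ g) : f = g :=
  (Sheaf.isSheaf_yoneda_obj W S hS).isSeparatedFor.ext h

theorem exists_hom_of_locally_functional (hS : S ∈ Sheaf.canonicalTopology C Z)
    (R : ∀ ⦃T : C⦄, (T ⟶ Z) → (T ⟶ W) → Prop)
    (precomp : ∀ ⦃T T' : C⦄ (j : T' ⟶ T) ⦃z : T ⟶ Z⦄ ⦃w : T ⟶ W⦄, R z w → R (j ≫ z) (j ≫ w))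
    (functional : ∀ ⦃T : C⦄ ⦃z : T ⟶ Z⦄ ⦃w w' : T ⟶ W⦄, R z w → R z w' → w = w')
    (total : ∀ ⦃T : C⦄ (z : T ⟶ Z), S z → ∃ w, R z w) :
    ∃ d : Z ⟶ W, ∀ ⦃T : C⦄ ⦃z : T ⟶ Z⦄ ⦃w : T ⟶ W⦄, R z w → z ≫ d = w := by
  choose w hw using total
  let family : Presieve.FamilyOfElements (yoneda.obj W) (S : Presieve Z) := fun _ z hz ↦ w z hz
  have compatible : family.Compatible := fun T₁ T₂ T j₁ j₂ z₁ z₂ h₁ h₂ comm ↦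
    functional (precomp j₁ (hw z₁ h₁)) (comm ▸ precomp j₂ (hw z₂ h₂))
  obtain ⟨d, hd, -⟩ := Sheaf.isSheaf_yoneda_obj W S hS family compatible
  refine ⟨d, fun T z w' hw' ↦ hom_ext_of_cover
    ((Sheaf.canonicalTopology C).pullback_stable z hS) fun T' j hj ↦ ?_⟩
  have hd' : (j ≫ z) ≫ d = w (j ≫ z) hj := hd (j ≫ z) hj
  rw [← Category.assoc, hd']
  exact functional (hw _ hj) (precomp j hw')

end Gluing

variable {C : Type u} [Category.{v} C] [HasFiniteLimits C]

attribute [local simp] pullback.lift_fst pullback.lift_snd pullback.lift_fst_assoc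
  pullback.lift_snd_assoc

/-! ### Lifting arrows along internal functors -/

/-- The generalised arrow `f` of `L` is the image under `p : P ⟶ L` of an arrow `x ⟶ y` of `P`.
When `p` is a discrete opfibration, this says that `y` is the transport of `x` along `f`; being a
relation, it needs no proof that `f` starts at the image of `x`. -/
def HasLift {P L : InternalCategory C} (p : P ⟶ L) {T : C} (f : T ⟶ L.arr) (x y : T ⟶ P.obj) :
    Prop :=
  ∃ a : T ⟶ P.arr, a ≫ P.s = x ∧ a ≫ p.arr = f ∧ a ≫ P.t = y

section HasLift

variable {P Q L : InternalCategory C} {p : P ⟶ L} {q : Q ⟶ L} {T : C}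

theorem hasLift_arr (p : P ⟶ L) (a : T ⟶ P.arr) : HasLift p (a ≫ p.arr) (a ≫ P.s) (a ≫ P.t) :=
  ⟨a, rfl, rfl, rfl⟩

theorem hasLift_id (p : P ⟶ L) (x : T ⟶ P.obj) : HasLift p (x ≫ p.obj ≫ L.e) x x :=
  ⟨x ≫ P.e, by simp [P.e_s], by simp [p.e_arr], by simp [P.e_t]⟩

namespace HasLift

variable {f : T ⟶ L.arr} {x y : T ⟶ P.obj}

theorem source (h : HasLift p f x y) : x ≫ p.obj = f ≫ L.s := by
  obtain ⟨a, rfl, rfl, -⟩ := h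
  simp [p.arr_s]

theorem target (h : HasLift p f x y) : y ≫ p.obj = f ≫ L.t := by
  obtain ⟨a, -, rfl, rfl⟩ := h
  simp [p.arr_t]

theorem precomp (h : HasLift p f x y) {T' : C} (j : T' ⟶ T) :
    HasLift p (j ≫ f) (j ≫ x) (j ≫ y) := by
  obtain ⟨a, rfl, rfl, rfl⟩ := h
  simpa using hasLift_arr p (j ≫ a)

theorem comp {g : T ⟶ L.arr} {z : T ⟶ P.obj} (h : HasLift p f x y) (h' : HasLift p g y z)
    (hfg : f ≫ L.t = g ≫ L.s) : HasLift p (L.comp f g hfg) x z := by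
  obtain ⟨a, rfl, rfl, rfl⟩ := h
  obtain ⟨b, hb, rfl, rfl⟩ := h'
  exact ⟨P.comp a b hb.symm, P.comp_s .., p.comp_arr .., P.comp_t ..⟩

theorem map (h : HasLift p f x y) {F : P ⟶ Q} (hF : F ≫ q = p) :
    HasLift q f (x ≫ F.obj) (y ≫ F.obj) := by
  obtain ⟨a, rfl, rfl, rfl⟩ := h
  subst hF
  exact ⟨a ≫ F.arr, by simp [F.arr_s], by simp, by simp [F.arr_t]⟩

theorem postcomp {M : InternalCategory C} (h : HasLift p f x y) (G : L ⟶ M) :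
    HasLift (p ≫ G) (f ≫ G.arr) x y := by
  obtain ⟨a, rfl, rfl, rfl⟩ := h
  exact ⟨a, rfl, by simp, rfl⟩

end HasLift

theorem isPullback_pb_obj {H K : InternalCategory C} (p : P ⟶ K) (Φ : H ⟶ K) :
    IsPullback (pbFst p Φ).obj (pbSnd p Φ).obj p.obj Φ.obj :=
  IsPullback.of_hasPullback _ _

theorem isPullback_pb_arr {H K : InternalCategory C} (p : P ⟶ K) (Φ : H ⟶ K) :
    IsPullback (pbFst p Φ).arr (pbSnd p Φ).arr p.arr Φ.arr :=
  IsPullback.of_hasPullback _ _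

theorem hasLift_pbSnd_iff {H K : InternalCategory C} {p : P ⟶ K} {Φ : H ⟶ K}
    {u : T ⟶ H.arr} {z w : T ⟶ (pb p Φ).obj} :
    HasLift (pbSnd p Φ) u z w ↔
      HasLift p (u ≫ Φ.arr) (z ≫ (pbFst p Φ).obj) (w ≫ (pbFst p Φ).obj) ∧
        z ≫ (pbSnd p Φ).obj = u ≫ H.s ∧ w ≫ (pbSnd p Φ).obj = u ≫ H.t := by
  refine ⟨fun h ↦ ⟨?_, h.source, h.target⟩, ?_⟩
  · obtain ⟨a, rfl, rfl, rfl⟩ := h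
    refine ⟨a ≫ (pbFst p Φ).arr, ?_, ?_, ?_⟩
    · simp [(pbFst p Φ).arr_s]
    · simp [(isPullback_pb_arr p Φ).w]
    · simp [(pbFst p Φ).arr_t]
  · rintro ⟨⟨a, has, hap, hat⟩, hz, hw⟩
    obtain ⟨b, rfl, rfl⟩ := (isPullback_pb_arr p Φ).exists_lift a u hap
    refine ⟨b, (isPullback_pb_obj p Φ).hom_ext ?_ ?_, rfl, (isPullback_pb_obj p Φ).hom_ext ?_ ?_⟩
    · simpa [(pbFst p Φ).arr_s] using has
    · simpa [(pbSnd p Φ).arr_s] using hz.symm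
    · simpa [(pbFst p Φ).arr_t] using hat
    · simpa [(pbSnd p Φ).arr_t] using hw.symm

end HasLift

/-! ### Discrete opfibrations -/

namespace IsDiscreteOpfibration

variable {P Q L : InternalCategory C} {p : P ⟶ L} {q : Q ⟶ L} {T : C}

theorem exists_hasLift (hp : IsDiscreteOpfibration p) {f : T ⟶ L.arr} {x : T ⟶ P.obj}
    (h : x ≫ p.obj = f ≫ L.s) : ∃ y, HasLift p f x y := by
  obtain ⟨a, ha, ha'⟩ := IsPullback.exists_lift hp x f h
  exact ⟨a ≫ P.t, a, ha, ha', rfl⟩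

theorem hasLift_unique (hp : IsDiscreteOpfibration p) {f : T ⟶ L.arr} {x y y' : T ⟶ P.obj}
    (h : HasLift p f x y) (h' : HasLift p f x y') : y = y' := by
  obtain ⟨a, rfl, rfl, rfl⟩ := h
  obtain ⟨b, hs, hb, rfl⟩ := h'
  rw [IsPullback.hom_ext hp hs hb]

theorem hasLift_of_cover (hp : IsDiscreteOpfibration p) {S : Sieve T}
    (hS : S ∈ Sheaf.canonicalTopology C T) {f : T ⟶ L.arr} {x y : T ⟶ P.obj}
    (h : ∀ ⦃T' : C⦄ (j : T' ⟶ T), S j → HasLift p (j ≫ f) (j ≫ x) (j ≫ y)) :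
    HasLift p f x y := by
  obtain ⟨y', hy'⟩ := hp.exists_hasLift (f := f) (x := x)
    (hom_ext_of_cover hS fun T' j hj ↦ by simpa using (h j hj).source)
  obtain rfl : y' = y :=
    hom_ext_of_cover hS fun T' j hj ↦ hp.hasLift_unique (hy'.precomp j) (h j hj)
  exact hy'

theorem functor_ext (hq : IsDiscreteOpfibration q) {F G : P ⟶ Q} (h : F ≫ q = G ≫ q)
    (hobj : F.obj = G.obj) : F = G :=
  hom_ext hobj (IsPullback.hom_ext hq (by rw [F.arr_s, G.arr_s, hobj]) (congrArg Hom.arr h))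

theorem exists_functor_of_obj (hq : IsDiscreteOpfibration q) (F₀ : P.obj ⟶ Q.obj)
    (hF₀ : HasLift q p.arr (P.s ≫ F₀) (P.t ≫ F₀)) : ∃ F : P ⟶ Q, F ≫ q = p ∧ F.obj = F₀ := by
  obtain ⟨F₁, hs, hq₁, ht⟩ := hF₀
  have hq₀ : F₀ ≫ q.obj = p.obj := by
    have h := P.e ≫= (hasLift_arr q F₁).source
    simpa [hs, hq₁, p.arr_s, reassoc_of% P.e_s] using h
  refine ⟨⟨F₀, F₁, hs, ht, ?_, ?_⟩, hom_ext hq₀ hq₁, rfl⟩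
  · apply IsPullback.hom_ext hq
    · simp [hs, reassoc_of% P.e_s, Q.e_s]
    · simp [hq₁, p.e_arr, q.e_arr, reassoc_of% hq₀]
  · change P.m ≫ F₁ = Q.comp _ _ _
    apply IsPullback.hom_ext hq
    · simp only [comp_s, Category.assoc, hs, reassoc_of% P.m_s]
    · simp only [q.comp_arr, Category.assoc, hq₁]
      exact p.m_arr

end IsDiscreteOpfibration

namespace DOFib

variable {K : InternalCategory C}

theorem hom_ext_of_obj {p q : DOFib K} {F G : p ⟶ q} (h : F.hom.left.obj = G.hom.left.obj) :
    F = G :=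
  InducedCategory.hom_ext (Over.OverMorphism.ext
    (q.property.functor_ext ((Over.w F.hom).trans (Over.w G.hom).symm) h))

theorem exists_hom_of_obj {p q : DOFib K} (F₀ : p.obj.left.obj ⟶ q.obj.left.obj)
    (hF₀ : HasLift q.obj.hom p.obj.hom.arr (p.obj.left.s ≫ F₀) (p.obj.left.t ≫ F₀)) :
    ∃ F : p ⟶ q, F.hom.left.obj = F₀ := by
  obtain ⟨F, hF, hF₀⟩ := q.property.exists_functor_of_obj F₀ hF₀
  exact ⟨ObjectProperty.homMk (Over.homMk F hF), hF₀⟩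

theorem isIso_of_isIso_obj {p q : DOFib K} (F : p ⟶ q) [IsIso F.hom.left.obj] : IsIso F := by
  have hobj : inv F.hom.left.obj ≫ p.obj.hom.obj = q.obj.hom.obj :=
    (IsIso.inv_comp_eq _).mpr (congrArg Hom.obj (Over.w F.hom)).symm
  have hinv : HasLift p.obj.hom q.obj.hom.arr (q.obj.left.s ≫ inv F.hom.left.obj)
      (q.obj.left.t ≫ inv F.hom.left.obj) := by
    obtain ⟨y, hy⟩ := p.property.exists_hasLift (f := q.obj.hom.arr)
      (x := q.obj.left.s ≫ inv F.hom.left.obj) (by simp [hobj, q.obj.hom.arr_s])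
    have hyF : y ≫ F.hom.left.obj = q.obj.left.t :=
      q.property.hasLift_unique (by simpa using hy.map (Over.w F.hom))
        (by simpa using hasLift_arr q.obj.hom (𝟙 _))
    simpa [← hyF] using hy
  obtain ⟨G, hG⟩ := exists_hom_of_obj _ hinv
  exact ⟨G, hom_ext_of_obj (by simp [hG]), hom_ext_of_obj (by simp [hG])⟩

end DOFib

namespace DOFib

variable {P Q H K : InternalCategory C} {Φ : H ⟶ K} {p : P ⟶ K} {q : Q ⟶ K}

theorem pullback_map_pbFst (Φ : H ⟶ K) {p q : DOFib K} (F : p ⟶ q) :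
    ((DOFib.pullback Φ).map F).hom.left ≫ pbFst q.obj.hom Φ = pbFst p.obj.hom Φ ≫ F.hom.left :=
  (isPullback_pb q.obj.hom Φ).lift_fst _ _ _

theorem functor_ext_of_faithful [(DOFib.pullback Φ).Faithful] (hp : IsDiscreteOpfibration p)
    (hq : IsDiscreteOpfibration q) {F G : P ⟶ Q} (hF : F ≫ q = p) (hG : G ≫ q = p)
    (h : pbFst p Φ ≫ F = pbFst p Φ ≫ G) : F = G := by
  let p' : DOFib K := ⟨Over.mk p, hp⟩
  let q' : DOFib K := ⟨Over.mk q, hq⟩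
  let F' : p' ⟶ q' := ObjectProperty.homMk (Over.homMk F hF)
  let G' : p' ⟶ q' := ObjectProperty.homMk (Over.homMk G hG)
  have hmap : (DOFib.pullback Φ).map F' = (DOFib.pullback Φ).map G' := by
    refine ObjectProperty.hom_ext _ (Over.OverMorphism.ext ((isPullback_pb q Φ).hom_ext ?_ ?_))
    · exact (pullback_map_pbFst Φ F').trans (h.trans (pullback_map_pbFst Φ G').symm)
    · exact (Over.w ((DOFib.pullback Φ).map F').hom).trans
        (Over.w ((DOFib.pullback Φ).map G').hom).symm
  exact congrArg (·.hom.left) ((DOFib.pullback Φ).map_injective hmap)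

theorem exists_functor_of_full [(DOFib.pullback Φ).Full] (hp : IsDiscreteOpfibration p)
    (hq : IsDiscreteOpfibration q) (G : pb p Φ ⟶ Q) (hG : G ≫ q = pbFst p Φ ≫ p) :
    ∃ F : P ⟶ Q, F ≫ q = p ∧ pbFst p Φ ≫ F = G := by
  let p' : DOFib K := ⟨Over.mk p, hp⟩
  let q' : DOFib K := ⟨Over.mk q, hq⟩
  have hG' : G ≫ q = pbSnd p Φ ≫ Φ := hG.trans (isPullback_pb p Φ).w
  let G' : (DOFib.pullback Φ).obj p' ⟶ (DOFib.pullback Φ).obj q' :=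
    ObjectProperty.homMk (Over.homMk (pbLift G (pbSnd p Φ) hG') (pbLift_snd _ _ _))
  obtain ⟨F, hF⟩ := (DOFib.pullback Φ).map_surjective G'
  exact ⟨F.hom.left, Over.w F.hom, (pullback_map_pbFst Φ F).symm.trans
    ((congrArg (·.hom.left ≫ pbFst q Φ) hF).trans (pbLift_fst _ _ hG'))⟩

end DOFib

/-! ### Discrete categories and effective descent morphisms -/

/-- A morphism out of the object of objects of `P` that coequalizes source and target, as an
internal functor from `P` to a categorically discrete internal category. -/
noncomputable def toDisc {P : InternalCategory C} {W : C} (x : P.obj ⟶ W)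
    (hx : P.s ≫ x = P.t ≫ x) : P ⟶ disc W where
  obj := x
  arr := P.s ≫ x
  arr_s := Category.comp_id _
  arr_t := (Category.comp_id _).trans hx
  e_arr := by simp [disc, reassoc_of% P.e_s]
  m_arr := by
    have h : P.m ≫ P.s ≫ x = pullback.fst P.t P.s ≫ P.s ≫ x := by rw [reassoc_of% P.m_s]
    exact h.trans (pullback.lift_fst _ _ _).symm

/-- A morphism `a : Z ⟶ Y` as an internal functor between categorically discrete internal
categories. It is a discrete opfibration, the one corresponding to the object `a` of the slice
over `Y`. -/
noncomputable def discMap {Z Y : C} (a : Z ⟶ Y) : disc Z ⟶ disc Y :=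
  toDisc a rfl

theorem functor_to_disc_ext {P : InternalCategory C} {W : C} {F G : P ⟶ disc W}
    (h : F.obj = G.obj) : F = G := by
  have harr (F : P ⟶ disc W) : F.arr = P.s ≫ F.obj := (Category.comp_id _).symm.trans F.arr_s
  exact hom_ext h (by rw [harr, harr, h])

theorem isDiscreteOpfibration_discMap {Z Y : C} (a : Z ⟶ Y) :
    IsDiscreteOpfibration (discMap a) := by
  have h : (discMap a).arr = a := Category.id_comp a
  rw [IsDiscreteOpfibration, h]
  exact IsPullback.of_id_fst

theorem eq_of_hasLift_disc {P : InternalCategory C} {T Y : C} {p : P ⟶ disc Y}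
    (hp : IsDiscreteOpfibration p) {f : T ⟶ (disc Y).arr} {x y : T ⟶ P.obj}
    (h : HasLift p f x y) : x = y := by
  have hf : x ≫ p.obj ≫ (disc Y).e = f := by
    rw [reassoc_of% h.source]
    exact (f ≫= Category.comp_id (𝟙 Y)).trans (Category.comp_id f)
  exact hp.hasLift_unique (hasLift_id p x) (hf ▸ h)

section EffectiveDescent

variable {X Y Z W : C} {f : X ⟶ Y}

theorem epi_pullback_fst_of_faithful [(DOFib.pullback (kernelToDisc f)).Faithful] (a : Z ⟶ Y) :
    Epi (pullback.fst a f) where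
  left_cancellation {W} d d' h := by
    have hfst : pullback.fst a f ≫ prod.lift a d = pullback.fst a f ≫ prod.lift a d' := by
      simp only [prod.comp_lift, h]
    have hover (c : Z ⟶ W) : discMap (prod.lift a c) ≫ discMap prod.fst = discMap a :=
      functor_to_disc_ext (prod.lift_fst a c)
    have heq : discMap (prod.lift a d) = discMap (prod.lift a d') :=
      DOFib.functor_ext_of_faithful (Φ := kernelToDisc f) (isDiscreteOpfibration_discMap a)
        (isDiscreteOpfibration_discMap _) (hover d) (hover d') (functor_to_disc_ext hfst)
    have hlift : prod.lift a d = prod.lift a d' := congrArg Hom.obj heq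
    simpa only [prod.lift_snd] using hlift =≫ prod.snd

theorem exists_pullback_fst_comp_eq_of_full [(DOFib.pullback (kernelToDisc f)).Full] (a : Z ⟶ Y)
    (x : pullback a f ⟶ W)
    (hx : ∀ ⦃T : C⦄ (y₁ y₂ : T ⟶ pullback a f),
      y₁ ≫ pullback.fst a f = y₂ ≫ pullback.fst a f → y₁ ≫ x = y₂ ≫ x) :
    ∃ d : Z ⟶ W, pullback.fst a f ≫ d = x := by
  have hlift ⦃T : C⦄ (y₁ y₂ : T ⟶ pullback a f)
      (h : y₁ ≫ pullback.fst a f = y₂ ≫ pullback.fst a f) :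
      y₁ ≫ prod.lift (pullback.fst a f ≫ a) x = y₂ ≫ prod.lift (pullback.fst a f ≫ a) x := by
    simp only [prod.comp_lift, reassoc_of% h, hx y₁ y₂ h]
  let G : pb (discMap a) (kernelToDisc f) ⟶ disc (Y ⨯ W) :=
    toDisc (prod.lift (pullback.fst a f ≫ a) x) (hlift _ _
      ((pbFst (discMap a) (kernelToDisc f)).arr_s.symm.trans (pbFst _ _).arr_t))
  obtain ⟨F, -, hF⟩ := DOFib.exists_functor_of_full (isDiscreteOpfibration_discMap a)
    (isDiscreteOpfibration_discMap prod.fst) G (functor_to_disc_ext (prod.lift_fst _ _))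
  have hF₀ : pullback.fst a f ≫ F.obj = prod.lift (pullback.fst a f ≫ a) x := congrArg Hom.obj hF
  exact ⟨F.obj ≫ prod.snd,
    (Category.assoc _ _ _).symm.trans ((hF₀ =≫ prod.snd).trans (prod.lift_snd _ _))⟩

theorem pullback_generate_singleton (f : X ⟶ Y) (a : Z ⟶ Y) :
    (Sieve.generate (Presieve.singleton f)).pullback a =
      Sieve.generate (Presieve.singleton (pullback.fst a f)) := by
  ext T z
  constructor
  · rintro ⟨_, x, _, ⟨⟩, h⟩
    exact ⟨_, pullback.lift z x h.symm, _, ⟨⟩, pullback.lift_fst _ _ _⟩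
  · rintro ⟨_, y, _, ⟨⟩, rfl⟩
    exact ⟨_, y ≫ pullback.snd a f, _, ⟨⟩, by simp [pullback.condition]⟩

theorem IsEffectiveDescent.generate_singleton_mem (hf : IsEffectiveDescent f) :
    Sieve.generate (Presieve.singleton f) ∈ Sheaf.canonicalTopology C Y := by
  have : (DOFib.pullback (kernelToDisc f)).IsEquivalence := hf
  refine Sheaf.mem_finestTopology_of_forall_isSheafFor ?_
  rintro _ ⟨W, rfl⟩ Z a
  rw [pullback_generate_singleton, ← Presieve.isSheafFor_iff_generate,
    Presieve.isSheafFor_singleton]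
  intro x hx
  obtain ⟨d, hd⟩ := exists_pullback_fst_comp_eq_of_full a x fun _ ↦ hx
  have := epi_pullback_fst_of_faithful (f := f) a
  exact ⟨d, hd, fun d' hd' ↦ (cancel_epi (pullback.fst a f)).mp (Eq.trans hd' hd.symm)⟩

end EffectiveDescent

theorem IsEffectiveDescent.exists_cover {X Y P Q : C} {f : X ⟶ Y} {c : P ⟶ Q} {b : P ⟶ X}
    {a : Q ⟶ Y} (hf : IsEffectiveDescent f) (sq : IsPullback c b a f) {T : C} (y : T ⟶ Q) :
    ∃ S ∈ Sheaf.canonicalTopology C T, ∀ ⦃T' : C⦄ (j : T' ⟶ T), S j →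
      ∃ z : T' ⟶ P, z ≫ c = j ≫ y := by
  refine ⟨_, (Sheaf.canonicalTopology C).pullback_stable (y ≫ a) hf.generate_singleton_mem, ?_⟩
  rintro T' j ⟨_, x, _, ⟨⟩, hx⟩
  obtain ⟨z, hz, -⟩ := sq.exists_lift (j ≫ y) x (by simpa using hx.symm)
  exact ⟨z, hz⟩

/-! ### Fully faithful functors -/

namespace IsFullyFaithful

variable {H K L : InternalCategory C} {Φ : H ⟶ K} {T : C}

theorem exists_arr (hΦ : IsFullyFaithful Φ) {k : T ⟶ K.arr} {h h' : T ⟶ H.obj}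
    (hs : h ≫ Φ.obj = k ≫ K.s) (ht : h' ≫ Φ.obj = k ≫ K.t) :
    ∃ u : T ⟶ H.arr, u ≫ Φ.arr = k ∧ u ≫ H.s = h ∧ u ≫ H.t = h' := by
  obtain ⟨u, hu, hst⟩ := IsPullback.exists_lift hΦ k (prod.lift h h')
    (by simp only [prod.comp_lift, prod.lift_map, hs, ht])
  exact ⟨u, hu, by simpa [prod.comp_lift, prod.lift_fst] using hst =≫ prod.fst,
    by simpa [prod.comp_lift, prod.lift_snd] using hst =≫ prod.snd⟩

theorem arr_ext (hΦ : IsFullyFaithful Φ) {u u' : T ⟶ H.arr} (h : u ≫ Φ.arr = u' ≫ Φ.arr)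
    (hs : u ≫ H.s = u' ≫ H.s) (ht : u ≫ H.t = u' ≫ H.t) : u = u' :=
  IsPullback.hom_ext hΦ h (by simp only [prod.comp_lift, hs, ht])

theorem exists_functor_of_obj (hΦ : IsFullyFaithful Φ) (G : L ⟶ K) (F₀ : L.obj ⟶ H.obj)
    (hF₀ : F₀ ≫ Φ.obj = G.obj) : ∃ F : L ⟶ H, F ≫ Φ = G ∧ F.obj = F₀ := by
  obtain ⟨F₁, hF₁, hs, ht⟩ := hΦ.exists_arr (k := G.arr) (h := L.s ≫ F₀) (h' := L.t ≫ F₀)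
    (by simp [hF₀, G.arr_s]) (by simp [hF₀, G.arr_t])
  refine ⟨⟨F₀, F₁, hs, ht, ?_, ?_⟩, hom_ext hF₀ hF₁, rfl⟩
  · apply hΦ.arr_ext
    · simp [hF₁, G.e_arr, Φ.e_arr, reassoc_of% hF₀]
    · simp [hs, reassoc_of% L.e_s, H.e_s]
    · simp [ht, reassoc_of% L.e_t, H.e_t]
  · change L.m ≫ F₁ = H.comp _ _ _
    apply hΦ.arr_ext
    · simp only [Φ.comp_arr, Category.assoc, hF₁]
      exact G.m_arr
    · simp only [comp_s, Category.assoc, hs, reassoc_of% L.m_s]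
    · simp only [comp_t, Category.assoc, ht, reassoc_of% L.m_t]

end IsFullyFaithful

/-! ### Pullback along a fully faithful functor that is of effective descent on objects -/

section Descent

variable {P Q H K : InternalCategory C} {Φ : H ⟶ K} {p : P ⟶ K} {q : Q ⟶ K}

theorem IsEffectiveDescent.faithful_pullback (hobj : IsEffectiveDescent Φ.obj) :
    (DOFib.pullback Φ).Faithful where
  map_injective {p q F G} h := by
    have : (DOFib.pullback (kernelToDisc Φ.obj)).IsEquivalence := hobj
    have : Epi (pbFst p.obj.hom Φ).obj := epi_pullback_fst_of_faithful p.obj.hom.obj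
    have hpb : pbFst p.obj.hom Φ ≫ F.hom.left = pbFst p.obj.hom Φ ≫ G.hom.left := by
      rw [← DOFib.pullback_map_pbFst, h, DOFib.pullback_map_pbFst]
    exact DOFib.hom_ext_of_obj ((cancel_epi (pbFst p.obj.hom Φ).obj).mp (congrArg Hom.obj hpb))

theorem IsFullyFaithful.hasLift_of_pb (hΦ : IsFullyFaithful Φ) {g : pb p Φ ⟶ Q}
    (hg : g ≫ q = pbSnd p Φ ≫ Φ) {T : C} {k : T ⟶ K.arr} {z w : T ⟶ (pb p Φ).obj}
    (h : HasLift p k (z ≫ (pbFst p Φ).obj) (w ≫ (pbFst p Φ).obj)) :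
    HasLift q k (z ≫ g.obj) (w ≫ g.obj) := by
  have hw := (isPullback_pb_obj p Φ).w
  obtain ⟨u, rfl, hs, ht⟩ := hΦ.exists_arr (k := k) (h := z ≫ (pbSnd p Φ).obj)
    (h' := w ≫ (pbSnd p Φ).obj) (by rw [← h.source, Category.assoc, Category.assoc, hw])
    (by rw [← h.target, Category.assoc, Category.assoc, hw])
  have hu : HasLift (pbSnd p Φ) u z w := hasLift_pbSnd_iff.mpr ⟨h, hs.symm, ht.symm⟩
  exact (hu.postcomp Φ).map hg

theorem IsFullyFaithful.comp_eq_of_pbFst_eq (hΦ : IsFullyFaithful Φ)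
    (hq : IsDiscreteOpfibration q) {g : pb p Φ ⟶ Q} (hg : g ≫ q = pbSnd p Φ ≫ Φ) {T : C}
    {z z' : T ⟶ (pb p Φ).obj} (h : z ≫ (pbFst p Φ).obj = z' ≫ (pbFst p Φ).obj) :
    z ≫ g.obj = z' ≫ g.obj := by
  have hg₀ : g.obj ≫ q.obj = (pbFst p Φ).obj ≫ p.obj :=
    (congrArg Hom.obj hg).trans (isPullback_pb_obj p Φ).w.symm
  have hid : HasLift q (z ≫ (pbFst p Φ).obj ≫ p.obj ≫ K.e) (z ≫ g.obj) (z ≫ g.obj) := by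
    simpa [reassoc_of% hg₀] using hasLift_id q (z ≫ g.obj)
  refine hq.hasLift_unique hid (hΦ.hasLift_of_pb hg ?_)
  rw [← h]
  simpa using hasLift_id p (z ≫ (pbFst p Φ).obj)

theorem IsFullyFaithful.exists_functor_of_pb (hΦ : IsFullyFaithful Φ)
    (hobj : IsEffectiveDescent Φ.obj) (hq : IsDiscreteOpfibration q) (g : pb p Φ ⟶ Q)
    (hg : g ≫ q = pbSnd p Φ ≫ Φ) : ∃ F : P ⟶ Q, F ≫ q = p ∧ pbFst p Φ ≫ F = g := by
  have : (DOFib.pullback (kernelToDisc Φ.obj)).IsEquivalence := hobj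
  have sq := isPullback_pb_obj p Φ
  obtain ⟨d, hd⟩ : ∃ d : P.obj ⟶ Q.obj, (pbFst p Φ).obj ≫ d = g.obj :=
    exists_pullback_fst_comp_eq_of_full p.obj g.obj fun _ _ _ h ↦ hΦ.comp_eq_of_pbFst_eq hq hg h
  have hlift : HasLift q p.arr (P.s ≫ d) (P.t ≫ d) := by
    obtain ⟨S₁, hS₁, hs⟩ := hobj.exists_cover sq P.s
    obtain ⟨S₂, hS₂, ht⟩ := hobj.exists_cover sq P.t
    refine hq.hasLift_of_cover
      ((Sheaf.canonicalTopology C).intersection_covering hS₁ hS₂) fun T j hj ↦ ?_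
    obtain ⟨z, hz⟩ := hs j hj.1
    obtain ⟨w, hw⟩ := ht j hj.2
    have h : HasLift p (j ≫ p.arr) (z ≫ (pbFst p Φ).obj) (w ≫ (pbFst p Φ).obj) := by
      rw [hz, hw]
      exact hasLift_arr p j
    simpa [← hd, reassoc_of% hz, reassoc_of% hw] using hΦ.hasLift_of_pb hg h
  obtain ⟨F, hF, hF₀⟩ := hq.exists_functor_of_obj d hlift
  refine ⟨F, hF, hq.functor_ext ?_ ?_⟩
  · rw [Category.assoc, hF, hg, (isPullback_pb p Φ).w]
  · rw [comp_obj', hF₀, hd]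

theorem IsFullyFaithful.full_pullback (hΦ : IsFullyFaithful Φ)
    (hobj : IsEffectiveDescent Φ.obj) : (DOFib.pullback Φ).Full where
  map_surjective {p q} G := by
    let G' : pb p.obj.hom Φ ⟶ pb q.obj.hom Φ := G.hom.left
    have hG : G' ≫ pbSnd q.obj.hom Φ = pbSnd p.obj.hom Φ := Over.w G.hom
    obtain ⟨F, hF, hFG⟩ := hΦ.exists_functor_of_pb hobj q.property (G' ≫ pbFst q.obj.hom Φ)
      (by rw [Category.assoc, (isPullback_pb _ _).w, reassoc_of% hG])
    let F' : p ⟶ q := ObjectProperty.homMk (Over.homMk F hF)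
    refine ⟨F', ObjectProperty.hom_ext _ (Over.OverMorphism.ext
      ((isPullback_pb q.obj.hom Φ).hom_ext ?_ ?_))⟩
    · exact (DOFib.pullback_map_pbFst Φ F').trans hFG
    · exact (Over.w ((DOFib.pullback Φ).map F').hom).trans hG.symm

end Descent

/-! ### Descent of the objects of a discrete opfibration -/

theorem IsEffectiveDescent.exists_isPullback {X Y : C} {f : X ⟶ Y} (hf : IsEffectiveDescent f)
    {Z : InternalCategory C} {ζ : Z ⟶ kernel f} (hζ : IsDiscreteOpfibration ζ) :
    ∃ (W : C) (π : W ⟶ Y) (c : Z.obj ⟶ W), IsPullback c ζ.obj π f ∧ Z.s ≫ c = Z.t ≫ c := by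
  have : (DOFib.pullback (kernelToDisc f)).IsEquivalence := hf
  let ζ' : DOFib (kernel f) := ⟨Over.mk ζ, hζ⟩
  let p := (DOFib.pullback (kernelToDisc f)).objPreimage ζ'
  let i := (DOFib.pullback (kernelToDisc f)).objObjPreimageIso ζ'
  let F : Z ⟶ pb p.obj.hom (kernelToDisc f) := i.inv.hom.left
  have hF : F ≫ pbSnd p.obj.hom (kernelToDisc f) = ζ := Over.w i.inv.hom
  have : IsIso F.obj := ⟨i.hom.hom.left.obj, congrArg (·.hom.left.obj) i.inv_hom_id,
    congrArg (·.hom.left.obj) i.hom_inv_id⟩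
  refine ⟨_, p.obj.hom.obj, F.obj ≫ (pbFst p.obj.hom (kernelToDisc f)).obj, ?_, ?_⟩
  · exact (isPullback_pb_obj p.obj.hom (kernelToDisc f)).of_iso' (asIso F.obj) (Iso.refl _)
      (Iso.refl _) (Iso.refl _) (Category.comp_id _).symm
      ((congrArg Hom.obj hF).trans (Category.comp_id _).symm)
      ((Category.id_comp _).trans (Category.comp_id _).symm)
      ((Category.id_comp _).trans (Category.comp_id _).symm)
  · have h := hasLift_arr ((F ≫ pbFst p.obj.hom (kernelToDisc f)) ≫ p.obj.hom) (𝟙 Z.arr)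
    simpa using eq_of_hasLift_disc p.property (h.map rfl)

/-- The inclusion of the identities of `K`. -/
noncomputable def discInclusion (K : InternalCategory C) : disc K.obj ⟶ K where
  obj := 𝟙 _
  arr := K.e
  arr_s := K.e_s.trans (Category.id_comp _).symm
  arr_t := K.e_t.trans (Category.id_comp _).symm
  e_arr := rfl
  m_arr := by
    have hfst : pullback.fst (𝟙 K.obj) (𝟙 K.obj) = pullback.snd (𝟙 K.obj) (𝟙 K.obj) := by
      simpa using pullback.condition (f := 𝟙 K.obj) (g := 𝟙 K.obj)
    refine (K.e_comp (pullback.fst (𝟙 K.obj) (𝟙 K.obj) ≫ K.e)).symm.trans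
      (K.comp_congr ?_ (hfst =≫ K.e) _)
    rw [Category.assoc, reassoc_of% K.e_s]
    rfl

/-- The objects of a discrete opfibration `ξ : X ⟶ H` descend along `Φ : H ⟶ K` to an object
`π : Y ⟶ K.obj` over the objects of `K`: the square formed by `c : X.obj ⟶ Y` is a pullback, and
`c` identifies the ends of every arrow of `X` that lies over an identity of `K`. -/
structure IsObjectDescent {X H K : InternalCategory C} (Φ : H ⟶ K) (ξ : X ⟶ H) {Y : C}
    (π : Y ⟶ K.obj) (c : X.obj ⟶ Y) : Prop where
  isPullback : IsPullback c ξ.obj π Φ.obj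
  comp_eq : ∀ ⦃T : C⦄ ⦃k : T ⟶ K.obj⦄ ⦃x x' : T ⟶ X.obj⦄,
    HasLift (ξ ≫ Φ) (k ≫ K.e) x x' → x ≫ c = x' ≫ c

section

variable {X H K : InternalCategory C} {Φ : H ⟶ K} {ξ : X ⟶ H}

theorem IsFullyFaithful.exists_functor_from_kernel (hΦ : IsFullyFaithful Φ) :
    ∃ κ : kernel Φ.obj ⟶ H, κ.obj = 𝟙 H.obj ∧ ∀ ⦃T : C⦄ ⦃u : T ⟶ H.arr⦄ ⦃k : T ⟶ K.obj⦄,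
      u ≫ Φ.arr = k ≫ K.e → ∃ g : T ⟶ (kernel Φ.obj).arr, g ≫ κ.arr = u := by
  obtain ⟨κ, hκ, hκ₀⟩ := hΦ.exists_functor_of_obj (kernelToDisc Φ.obj ≫ discInclusion K)
    (𝟙 H.obj) ((Category.id_comp _).trans (Category.comp_id _).symm)
  refine ⟨κ, hκ₀, fun T u k huk ↦ ?_⟩
  have hus : (u ≫ H.s) ≫ Φ.obj = k := by simp [← Φ.arr_s, reassoc_of% huk, K.e_s]
  have hut : (u ≫ H.t) ≫ Φ.obj = k := by simp [← Φ.arr_t, reassoc_of% huk, K.e_t]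
  have hκs : κ.arr ≫ H.s = pullback.fst Φ.obj Φ.obj :=
    κ.arr_s.trans ((congrArg (_ ≫ ·) hκ₀).trans (Category.comp_id _))
  have hκt : κ.arr ≫ H.t = pullback.snd Φ.obj Φ.obj :=
    κ.arr_t.trans ((congrArg (_ ≫ ·) hκ₀).trans (Category.comp_id _))
  have hκΦ : κ.arr ≫ Φ.arr = (pullback.fst Φ.obj Φ.obj ≫ Φ.obj) ≫ K.e := congrArg Hom.arr hκ
  let g : T ⟶ pullback Φ.obj Φ.obj := pullback.lift (u ≫ H.s) (u ≫ H.t) (hus.trans hut.symm)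
  refine ⟨g, hΦ.arr_ext ?_ ?_ ?_⟩
  · refine (Category.assoc _ _ _).trans ((congrArg (g ≫ ·) hκΦ).trans ?_)
    simp only [g, Category.assoc, pullback.lift_fst_assoc, huk, ← hus]
  · refine (Category.assoc _ _ _).trans ((congrArg (g ≫ ·) hκs).trans (pullback.lift_fst _ _ _))
  · refine (Category.assoc _ _ _).trans ((congrArg (g ≫ ·) hκt).trans (pullback.lift_snd _ _ _))

theorem IsFullyFaithful.exists_isObjectDescent (hΦ : IsFullyFaithful Φ)
    (hobj : IsEffectiveDescent Φ.obj) (hξ : IsDiscreteOpfibration ξ) :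
    ∃ (Y : C) (π : Y ⟶ K.obj) (c : X.obj ⟶ Y), IsObjectDescent Φ ξ π c := by
  obtain ⟨κ, hκ₀, hκ⟩ := hΦ.exists_functor_from_kernel
  obtain ⟨Y, π, c, hc, hst⟩ := hobj.exists_isPullback (hξ.pbSnd κ)
  have : IsIso κ.obj := hκ₀ ▸ inferInstanceAs (IsIso (𝟙 H.obj))
  have sq := isPullback_pb_obj ξ κ
  have : IsIso (pbFst ξ κ).obj := sq.isIso_fst_of_isIso
  let i := inv (pbFst ξ κ).obj
  have hi : i ≫ (pbSnd ξ κ).obj ≫ κ.obj = ξ.obj := (IsIso.inv_comp_eq _).mpr sq.w.symm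
  have hi' : i ≫ (pbSnd ξ κ).obj = ξ.obj := by
    refine Eq.trans ?_ hi
    exact congrArg (i ≫ ·) ((congrArg (_ ≫ ·) hκ₀).trans (Category.comp_id _)).symm
  refine ⟨Y, π, i ≫ c, ?_, fun T k x x' h ↦ ?_⟩
  · exact hc.of_iso' (asIso i) (Iso.refl _) (Iso.refl _) (Iso.refl _) (Category.comp_id _).symm
      (hi'.trans (Category.comp_id _).symm)
      ((Category.id_comp _).trans (Category.comp_id _).symm)
      ((Category.id_comp _).trans (Category.comp_id _).symm)
  · obtain ⟨a, rfl, ha, rfl⟩ := h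
    obtain ⟨g, hg⟩ := hκ ((Category.assoc _ _ _).trans ha)
    obtain ⟨b, rfl, -⟩ := (isPullback_pb_arr ξ κ).exists_lift a g hg.symm
    have hs : (pbFst ξ κ).arr ≫ X.s ≫ i = (pb ξ κ).s := by
      simp [i, reassoc_of% (pbFst ξ κ).arr_s]
    have ht : (pbFst ξ κ).arr ≫ X.t ≫ i = (pb ξ κ).t := by
      simp [i, reassoc_of% (pbFst ξ κ).arr_t]
    simp [reassoc_of% hs, reassoc_of% ht, hst]

/-! ### Transport along the arrows of `K` -/

theorem IsFullyFaithful.hasLift_of_comp (hΦ : IsFullyFaithful Φ) (hξ : IsDiscreteOpfibration ξ)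
    {T : C} {f g : T ⟶ K.arr} {x y z : T ⟶ X.obj} (hfg : f ≫ K.t = g ≫ K.s)
    (h : HasLift (ξ ≫ Φ) f x y) (h' : HasLift (ξ ≫ Φ) (K.comp f g hfg) x z) :
    HasLift (ξ ≫ Φ) g y z := by
  have hy := h.target
  have hz := h'.target
  obtain ⟨a, rfl, rfl, rfl⟩ := h
  obtain ⟨b, hs, hb, rfl⟩ := h'
  obtain ⟨u, rfl, hus, hut⟩ := hΦ.exists_arr (k := g) (h := a ≫ ξ.arr ≫ H.t)
    (h' := b ≫ ξ.arr ≫ H.t) (by simpa [ξ.arr_t, ← hfg] using hy)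
    (by simpa [ξ.arr_t, comp_t] using hz)
  have hau : (a ≫ ξ.arr) ≫ H.t = u ≫ H.s := by simp [hus]
  have hcomp : H.comp (a ≫ ξ.arr) u hau = b ≫ ξ.arr := by
    apply hΦ.arr_ext
    · simpa [Φ.comp_arr] using hb.symm
    · simp [comp_s, ξ.arr_s, reassoc_of% hs]
    · simp [comp_t, hut]
  obtain ⟨y, hy⟩ := hξ.exists_hasLift (f := u) (x := a ≫ X.t) (by simp [hus, ξ.arr_t])
  obtain rfl : y = b ≫ X.t := hξ.hasLift_unique ((hasLift_arr ξ a).comp hy hau)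
    (by rw [hcomp, ← hs]; exact hasLift_arr ξ b)
  exact hy.postcomp Φ

/-- The object `w` of `Y` is the transport of `y` along the arrow `k` of `K`, as witnessed by an
arrow of `X` between preimages of `y` and `w` under `c : X.obj ⟶ Y`. -/
def HasDescentLift (Φ : H ⟶ K) (ξ : X ⟶ H) {Y : C} (c : X.obj ⟶ Y) {T : C} (k : T ⟶ K.arr)
    (y w : T ⟶ Y) : Prop :=
  ∃ x x', HasLift (ξ ≫ Φ) k x x' ∧ x ≫ c = y ∧ x' ≫ c = w

theorem HasLift.hasDescentLift {Y : C} {T : C} {k : T ⟶ K.arr} {x x' : T ⟶ X.obj}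
    (h : HasLift (ξ ≫ Φ) k x x') (c : X.obj ⟶ Y) : HasDescentLift Φ ξ c k (x ≫ c) (x' ≫ c) :=
  ⟨x, x', h, rfl, rfl⟩

theorem HasDescentLift.precomp {Y T T' : C} {c : X.obj ⟶ Y} {k : T ⟶ K.arr} {y w : T ⟶ Y}
    (h : HasDescentLift Φ ξ c k y w) (j : T' ⟶ T) :
    HasDescentLift Φ ξ c (j ≫ k) (j ≫ y) (j ≫ w) := by
  obtain ⟨x, x', h, rfl, rfl⟩ := h
  simpa using (h.precomp j).hasDescentLift c

namespace IsObjectDescent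

variable {Y T : C} {π : Y ⟶ K.obj} {c : X.obj ⟶ Y} (hc : IsObjectDescent Φ ξ π c)
  (hΦ : IsFullyFaithful Φ) (hξ : IsDiscreteOpfibration ξ)
include hc

theorem target_eq {k : T ⟶ K.arr} {y w : T ⟶ Y} (h : HasDescentLift Φ ξ c k y w) :
    w ≫ π = k ≫ K.t := by
  obtain ⟨x, x', h, rfl, rfl⟩ := h
  rw [← h.target, Category.assoc, hc.isPullback.w, comp_obj']

include hΦ hξ

theorem hasLift_of_comp_eq {x x' : T ⟶ X.obj} (h : x ≫ c = x' ≫ c) :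
    HasLift (ξ ≫ Φ) (x ≫ (ξ ≫ Φ).obj ≫ K.e) x x' := by
  have hw (z : T ⟶ X.obj) : z ≫ ξ.obj ≫ Φ.obj = (z ≫ c) ≫ π := by simp [hc.isPullback.w]
  obtain ⟨u, hu, hs, ht⟩ := hΦ.exists_arr (k := x ≫ (ξ ≫ Φ).obj ≫ K.e) (h := x ≫ ξ.obj)
    (h' := x' ≫ ξ.obj) (by simp [K.e_s]) (by simp [K.e_t, hw, h])
  obtain ⟨y, hy⟩ := hξ.exists_hasLift hs.symm
  have hlift : HasLift (ξ ≫ Φ) (x ≫ (ξ ≫ Φ).obj ≫ K.e) x y := hu ▸ hy.postcomp Φ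
  obtain rfl : y = x' := hc.isPullback.hom_ext
    ((hc.comp_eq (k := x ≫ (ξ ≫ Φ).obj) (by simpa using hlift)).symm.trans h) (hy.target.trans ht)
  exact hlift

theorem hasLift_of_comp_eq_of_hasLift {k : T ⟶ K.arr} {x x' y : T ⟶ X.obj}
    (h : x ≫ c = x' ≫ c) (h' : HasLift (ξ ≫ Φ) k x' y) : HasLift (ξ ≫ Φ) k x y := by
  have hs : (x ≫ (ξ ≫ Φ).obj ≫ K.e) = k ≫ K.s ≫ K.e := by
    rw [← reassoc_of% h'.source]
    simp [← hc.isPullback.w, reassoc_of% h]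
  have hx := hc.hasLift_of_comp_eq hΦ hξ h
  rw [hs] at hx
  simpa [K.e_comp] using hx.comp h' (by simp [K.e_t])

theorem hasDescentLift_unique {k : T ⟶ K.arr} {y w w' : T ⟶ Y} (h : HasDescentLift Φ ξ c k y w)
    (h' : HasDescentLift Φ ξ c k y w') : w = w' := by
  obtain ⟨x₁, x, hx, rfl, rfl⟩ := h
  obtain ⟨x₁', x', hx', h₁, rfl⟩ := h'
  replace hx' := hc.hasLift_of_comp_eq_of_hasLift hΦ hξ h₁.symm hx'
  refine hc.comp_eq (k := k ≫ K.t) (hΦ.hasLift_of_comp hξ (by simp [K.e_s]) hx ?_)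
  simpa [K.comp_e] using hx'

theorem hasDescentLift_comp {f g : T ⟶ K.arr} {y w v : T ⟶ Y} (hfg : f ≫ K.t = g ≫ K.s)
    (h : HasDescentLift Φ ξ c f y w) (h' : HasDescentLift Φ ξ c g w v) :
    HasDescentLift Φ ξ c (K.comp f g hfg) y v := by
  obtain ⟨x, x', hx, rfl, rfl⟩ := h
  obtain ⟨z, z', hz, hzx, rfl⟩ := h'
  exact (hx.comp (hc.hasLift_of_comp_eq_of_hasLift hΦ hξ hzx.symm hz) hfg).hasDescentLift c

theorem exists_cover_hasDescentLift (hobj : IsEffectiveDescent Φ.obj) {k : T ⟶ K.arr} {y : T ⟶ Y}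
    (h : y ≫ π = k ≫ K.s) :
    ∃ S ∈ Sheaf.canonicalTopology C T, ∀ ⦃T' : C⦄ (j : T' ⟶ T), S j →
      ∃ w, HasDescentLift Φ ξ c (j ≫ k) (j ≫ y) w := by
  obtain ⟨S₁, hS₁, hy⟩ := hobj.exists_cover hc.isPullback y
  obtain ⟨S₂, hS₂, hk⟩ := hobj.exists_cover (.of_id_snd (f := Φ.obj)) (k ≫ K.t)
  refine ⟨_, (Sheaf.canonicalTopology C).intersection_covering hS₁ hS₂, fun T' j hj ↦ ?_⟩
  obtain ⟨x, hx⟩ := hy j hj.1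
  obtain ⟨h', hh'⟩ := hk j hj.2
  obtain ⟨u, hu, hs, -⟩ := hΦ.exists_arr (k := j ≫ k) (h := x ≫ ξ.obj) (h' := h')
    (by simp [← hc.isPullback.w, reassoc_of% hx, h]) (by simp [hh'])
  obtain ⟨x', hx'⟩ := hξ.exists_hasLift hs.symm
  exact ⟨x' ≫ c, x, x', hu ▸ hx'.postcomp Φ, hx, rfl⟩

end IsObjectDescent

end

/-! ### Actions and their categories of elements -/

/-- An action of `L` on an object `proj : obj ⟶ L.obj` over its object of objects, that is, an
internal diagram on `L`. Actions correspond to discrete opfibrations over `L` by the category of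
elements construction `Action.total`. In `act_comp`, the generalised elements `a = (y, f)` and
`b = (act a, g)` range over the pairs to which the action applies. -/
structure Action (L : InternalCategory C) where
  /-- the object acted upon -/
  obj : C
  /-- the structure map of the object acted upon -/
  proj : obj ⟶ L.obj
  /-- transport of an element of `obj` along an arrow of `L` out of its projection -/
  act : pullback proj L.s ⟶ obj
  act_proj : act ≫ proj = pullback.snd proj L.s ≫ L.t
  act_id : pullback.lift (𝟙 obj) (proj ≫ L.e) (by simp [L.e_s]) ≫ act = 𝟙 obj
  act_comp : ∀ ⦃T : C⦄ (a b : T ⟶ pullback proj L.s) (h : a ≫ act = b ≫ pullback.fst proj L.s),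
    pullback.lift (a ≫ pullback.fst proj L.s)
        (L.comp (a ≫ pullback.snd proj L.s) (b ≫ pullback.snd proj L.s)
          (by rw [Category.assoc, ← act_proj, reassoc_of% h, pullback.condition, Category.assoc]))
        (by rw [comp_s, Category.assoc, Category.assoc, pullback.condition]) ≫ act =
      b ≫ act

namespace Action

variable {L : InternalCategory C} (A : Action L)

/-- The category of elements of an action: an arrow out of `y` is an arrow of `L` out of the
projection of `y`, and ends at the transport of `y`. -/
noncomputable def total : InternalCategory C where
  obj := A.obj
  arr := pullback A.proj L.s
  s := pullback.fst _ _
  t := A.act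
  e := pullback.lift (𝟙 A.obj) (A.proj ≫ L.e) (by simp [L.e_s])
  m := pullback.lift (pullback.fst _ _ ≫ pullback.fst _ _)
    (L.comp (pullback.fst _ _ ≫ pullback.snd _ _) (pullback.snd _ _ ≫ pullback.snd _ _) (by
      rw [Category.assoc, ← A.act_proj, pullback.condition_assoc, pullback.condition,
        Category.assoc]))
    (by simp only [comp_s, Category.assoc, pullback.condition])
  e_s := by simp
  e_t := A.act_id
  m_s := by simp
  m_t := A.act_comp _ _ pullback.condition
  m_assoc := by
    apply pullback.hom_ext
    · simp
    · simp only [Category.assoc, pullback.lift_snd, precomp_comp]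
      simp only [pullback.lift_fst_assoc, pullback.lift_snd_assoc, Category.assoc,
        pullback.lift_snd, precomp_comp]
      exact L.comp_assoc _ _ _ _ _
  e_m := by
    apply pullback.hom_ext
    · simp
    · simp only [Category.assoc, pullback.lift_snd, precomp_comp, Category.id_comp]
      refine Eq.trans (L.comp_congr ?_ ?_ _) (L.e_comp (pullback.snd _ _))
      · simp [pullback.condition_assoc]
      · simp
  m_e := by
    apply pullback.hom_ext
    · simp
    · simp only [Category.assoc, pullback.lift_snd, precomp_comp, Category.id_comp]
      refine Eq.trans (L.comp_congr ?_ ?_ _) (L.comp_e (pullback.snd _ _))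
      · simp
      · simp [reassoc_of% A.act_proj]

/-- The projection from the category of elements. -/
noncomputable def totalProj : A.total ⟶ L where
  obj := A.proj
  arr := pullback.snd _ _
  arr_s := pullback.condition.symm
  arr_t := A.act_proj.symm
  e_arr := pullback.lift_snd _ _ _
  m_arr := pullback.lift_snd _ _ _

theorem isDiscreteOpfibration_totalProj : IsDiscreteOpfibration A.totalProj :=
  IsPullback.of_hasPullback A.proj L.s

theorem hasLift_totalProj {T : C} {k : T ⟶ L.arr} {y w : T ⟶ A.obj} (h : y ≫ A.proj = k ≫ L.s)
    (hw : pullback.lift y k h ≫ A.act = w) : HasLift A.totalProj k y w :=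
  ⟨pullback.lift y k h, pullback.lift_fst _ _ _, pullback.lift_snd _ _ _, hw⟩

end Action

section

variable {X H K : InternalCategory C} {Φ : H ⟶ K} {ξ : X ⟶ H} {Y : C} {π : Y ⟶ K.obj}
  {c : X.obj ⟶ Y}

/-- The morphism `act` sends every pair `(y, k)` to the transport of `y` along `k`, whenever such a
transport is witnessed by an arrow of `X`. -/
def IsDescentAction (Φ : H ⟶ K) (ξ : X ⟶ H) (π : Y ⟶ K.obj) (c : X.obj ⟶ Y)
    (act : pullback π K.s ⟶ Y) : Prop :=
  ∀ ⦃T : C⦄ ⦃z : T ⟶ pullback π K.s⦄ ⦃w : T ⟶ Y⦄,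
    HasDescentLift Φ ξ c (z ≫ pullback.snd π K.s) (z ≫ pullback.fst π K.s) w → z ≫ act = w

theorem IsObjectDescent.exists_isDescentAction (hc : IsObjectDescent Φ ξ π c)
    (hΦ : IsFullyFaithful Φ) (hobj : IsEffectiveDescent Φ.obj) (hξ : IsDiscreteOpfibration ξ) :
    ∃ act, IsDescentAction Φ ξ π c act := by
  obtain ⟨S, hS, h⟩ := hc.exists_cover_hasDescentLift hΦ hξ hobj (pullback.condition (f := π))
  exact exists_hom_of_locally_functional hS _ (fun T T' j z w h ↦ by simpa using h.precomp j)
    (fun T z w w' h h' ↦ hc.hasDescentLift_unique hΦ hξ h h') h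

namespace IsDescentAction

variable {act : pullback π K.s ⟶ Y} (hact : IsDescentAction Φ ξ π c act)
  (hc : IsObjectDescent Φ ξ π c) (hΦ : IsFullyFaithful Φ) (hobj : IsEffectiveDescent Φ.obj)
  (hξ : IsDiscreteOpfibration ξ)
include hact hc hobj

theorem act_id (h : 𝟙 Y ≫ π = (π ≫ K.e) ≫ K.s) :
    pullback.lift (𝟙 Y) (π ≫ K.e) h ≫ act = 𝟙 Y := by
  obtain ⟨S, hS, hx⟩ := hobj.exists_cover hc.isPullback (𝟙 Y)
  refine hom_ext_of_cover hS fun T j hj ↦ ?_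
  obtain ⟨x, hx⟩ := hx j hj
  obtain rfl : x ≫ c = j := by simpa using hx
  have hid : HasDescentLift Φ ξ c (x ≫ (ξ ≫ Φ).obj ≫ K.e) (x ≫ c) (x ≫ c) :=
    (hasLift_id (ξ ≫ Φ) x).hasDescentLift c
  rw [← Category.assoc]
  refine hact ?_
  simpa [reassoc_of% hc.isPullback.w] using hid

include hΦ hξ

theorem exists_cover {T : C} (z : T ⟶ pullback π K.s) :
    ∃ S ∈ Sheaf.canonicalTopology C T, ∀ ⦃T' : C⦄ (j : T' ⟶ T), S j →
      HasDescentLift Φ ξ c (j ≫ z ≫ pullback.snd π K.s) (j ≫ z ≫ pullback.fst π K.s)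
        (j ≫ z ≫ act) := by
  obtain ⟨S, hS, h⟩ := hc.exists_cover_hasDescentLift hΦ hξ hobj
    (k := z ≫ pullback.snd π K.s) (y := z ≫ pullback.fst π K.s)
    (by simp only [Category.assoc, pullback.condition])
  refine ⟨S, hS, fun T' j hj ↦ ?_⟩
  obtain ⟨w, hw⟩ := h j hj
  have hjw : (j ≫ z) ≫ act = w := hact (by simpa only [Category.assoc] using hw)
  rwa [← Category.assoc j z act, hjw]

theorem act_proj : act ≫ π = pullback.snd π K.s ≫ K.t := by
  obtain ⟨S, hS, h⟩ := hact.exists_cover hc hΦ hobj hξ (𝟙 _)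
  exact hom_ext_of_cover hS fun T j hj ↦ by simpa using hc.target_eq (h j hj)

theorem act_comp {T : C} (a b : T ⟶ pullback π K.s) (hab : a ≫ act = b ≫ pullback.fst π K.s)
    (hk : (a ≫ pullback.snd π K.s) ≫ K.t = (b ≫ pullback.snd π K.s) ≫ K.s)
    (hy : (a ≫ pullback.fst π K.s) ≫ π =
      K.comp (a ≫ pullback.snd π K.s) (b ≫ pullback.snd π K.s) hk ≫ K.s) :
    pullback.lift (a ≫ pullback.fst π K.s) (K.comp _ _ hk) hy ≫ act = b ≫ act := by
  obtain ⟨S₁, hS₁, ha⟩ := hact.exists_cover hc hΦ hobj hξ a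
  obtain ⟨S₂, hS₂, hb⟩ := hact.exists_cover hc hΦ hobj hξ b
  refine hom_ext_of_cover ((Sheaf.canonicalTopology C).intersection_covering hS₁ hS₂)
    fun T' j hj ↦ ?_
  have hja := ha j hj.1
  rw [hab] at hja
  have hcomp := hc.hasDescentLift_comp hΦ hξ
    (by simpa only [Category.assoc] using j ≫= hk) hja (hb j hj.2)
  rw [← Category.assoc]
  refine hact ?_
  simpa [precomp_comp] using hcomp

end IsDescentAction

theorem IsFullyFaithful.exists_action (hΦ : IsFullyFaithful Φ) (hobj : IsEffectiveDescent Φ.obj)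
    (hξ : IsDiscreteOpfibration ξ) :
    ∃ (A : Action K) (c : X.obj ⟶ A.obj), IsPullback c ξ.obj A.proj Φ.obj ∧
      HasLift A.totalProj (ξ ≫ Φ).arr (X.s ≫ c) (X.t ≫ c) := by
  obtain ⟨Y, π, c, hc⟩ := hΦ.exists_isObjectDescent hobj hξ
  obtain ⟨act, hact⟩ := hc.exists_isDescentAction hΦ hobj hξ
  have hs : (X.s ≫ c) ≫ π = (ξ ≫ Φ).arr ≫ K.s := by
    rw [Category.assoc, hc.isPullback.w]
    exact (ξ ≫ Φ).arr_s.symm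
  have hlift : pullback.lift (X.s ≫ c) (ξ ≫ Φ).arr hs ≫ act = X.t ≫ c :=
    hact (by simpa using (hasLift_arr (ξ ≫ Φ) (𝟙 _)).hasDescentLift c)
  let A : Action K :=
    { obj := Y
      proj := π
      act := act
      act_proj := hact.act_proj hc hΦ hobj hξ
      act_id := hact.act_id hc hobj _
      act_comp := fun T a b h ↦ hact.act_comp hc hΦ hobj hξ a b h _ _ }
  exact ⟨A, c, hc.isPullback, A.hasLift_totalProj hs hlift⟩

theorem IsFullyFaithful.essSurj_pullback (hΦ : IsFullyFaithful Φ)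
    (hobj : IsEffectiveDescent Φ.obj) : (DOFib.pullback Φ).EssSurj where
  mem_essImage ξ := by
    obtain ⟨A, c, hc, hA⟩ := hΦ.exists_action hobj ξ.property
    let q : DOFib K := ⟨Over.mk A.totalProj, A.isDiscreteOpfibration_totalProj⟩
    let i : ξ.obj.left.obj ≅ (pb A.totalProj Φ).obj := hc.isoPullback
    have hi : HasLift (pbSnd A.totalProj Φ) ξ.obj.hom.arr (ξ.obj.left.s ≫ i.hom)
        (ξ.obj.left.t ≫ i.hom) := by
      have hfst : i.hom ≫ (pbFst A.totalProj Φ).obj = c := hc.isoPullback_hom_fst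
      have hsnd : i.hom ≫ (pbSnd A.totalProj Φ).obj = ξ.obj.hom.obj := hc.isoPullback_hom_snd
      refine hasLift_pbSnd_iff.mpr ⟨?_, ?_, ?_⟩
      · rw [Category.assoc, Category.assoc, hfst]
        exact hA
      · rw [Category.assoc, hsnd, Hom.arr_s]
      · rw [Category.assoc, hsnd, Hom.arr_t]
    obtain ⟨F, hF⟩ := DOFib.exists_hom_of_obj (q := (DOFib.pullback Φ).obj q) i.hom hi
    have : IsIso F.hom.left.obj := hF ▸ i.isIso_hom
    have := DOFib.isIso_of_isIso_obj F
    exact ⟨q, ⟨(asIso F).symm⟩⟩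

end

end InternalCategory

theorem mainTheorem5 {C : Type u} [Category.{v} C] [HasFiniteLimits C]
    {H K : InternalCategory C} (Φ : H ⟶ K)
    (hff : InternalCategory.IsFullyFaithful Φ)
    (hobj : InternalCategory.IsEffectiveDescent Φ.obj) :
    (InternalCategory.DOFib.pullback Φ).IsEquivalence :=
  { faithful := hobj.faithful_pullback
    full := hff.full_pullback hobj
    essSurj := hff.essSurj_pullback hobj }
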